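/- Let $T\ge 1$ be an integer, and let $\mathcal U_T$ be the set of real trinomials $P(z)=z+xz^{1+T}+yz^{1+2T}$ ($x,y\in\mathbb R$) that are univalent (injective) in the open unit disk $\mathbb D$. Let $$S^{(T)}(z)=z+\sum_{j=2}^{3}\left(1-\frac{(j-1)T}{1+2T}\right)\prod_{k=1}^{j-1}\frac{\sin\frac{\pi(2+T(k-1))}{2+2T}}{\sin\frac{\pi Tk}{2+2T}}\,z^{T(j-1)+1},$$ and let $Q^{(T)}(z)=e^{-i\pi/T}S^{(T)}(e^{i\pi/T}z)$, a polynomial with real coefficients. Then $$S^{(T)}(z)=z+\frac{2(1+T)}{1+2T}\sin\frac{\pi}{2+2T}\,z^{1+T}+\frac{1}{1+2T}z^{1+2T},$$ $Q^{(T)}(z)=-S^{(T)}(-z)$ if $T$ is odd, both $S^{(T)}$ and $Q^{(T)}$ belong to $\mathcal U_T$ and have leading coefficient $\frac1{1+2T}$, and the following hold. (c) If $P\in\mathcal U_T$ has coefficient $\frac1{1+2T}$ at $z^{1+2T}$, then the absolute value of each coefficient of $P$ is at most the corresponding coefficient of $S^{(T)}$. The absolute value of the coefficient of $P$ at $z^{1+T}$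 equals the coefficient of $S^{(T)}$ at $z^{1+T}$ if and only if $P=S^{(T)}$ or $P=Q^{(T)}$. (d) $\displaystyle\max_{P\in\mathcal U_T}\max_{|z|\le1}|P(z)|=S^{(T)}(1)$, and for $P\in\mathcal U_T$ one has $\max_{|z|\le1}|P(z)|=S^{(T)}(1)$ if and only if $P=S^{(T)}$ or $P=Q^{(T)}$. (e) $P(1)>0$ for every $P\in\mathcal U_T$, and $$\min_{P\in\mathcal U_T}\frac{|P(e^{i\pi/T})|}{P(1)}=\frac{|S^{(T)}(e^{i\pi/T})|}{S^{(T)}(1)}=\left(\frac{1-\sin\frac{\pi}{2+2T}}{\cos\frac{\pi}{2+2T}}\right)^2,$$ and $S^{(T)}$ is the only polynomial in $\mathcal U_T$ that attains the minimum. -/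

import Mathlib

open Polynomial

noncomputable section

/-- The real trinomial `z + x z^(1+T) + y z^(1+2T)`. -/
def trinomialT (T : ℕ) (x y : ℝ) : ℝ[X] :=
  X + C x * X ^ (1 + T) + C y * X ^ (1 + 2 * T)

/-- The `T`-symmetric real trinomials `z + x z^(1+T) + y z^(1+2T)` that are univalent
(injective) in the open unit disk. -/
def univalentTrinomials (T : ℕ) : Set ℝ[X] :=
  {P | (∃ x y : ℝ, P = trinomialT T x y) ∧
    Set.InjOn (fun z : ℂ => aeval z P) (Metric.ball 0 1)}

/-- The `T`-symmetric analogue `S^(T)` of the Suffridge polynomial, of degree `1 + (n-1) T`. -/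
def suffridgeT (T n : ℕ) : ℝ[X] :=
  X + ∑ j ∈ Finset.Icc 2 n,
    C ((1 - ((j : ℝ) - 1) * T / (1 + ((n : ℝ) - 1) * T)) *
        ∏ k ∈ Finset.Icc 1 (j - 1),
          (Real.sin (Real.pi * (2 + (T : ℝ) * ((k : ℝ) - 1)) / (2 + (T : ℝ) * ((n : ℝ) - 1))) /
            Real.sin (Real.pi * (T : ℝ) * (k : ℝ) / (2 + (T : ℝ) * ((n : ℝ) - 1))))) *
      X ^ (T * (j - 1) + 1)

/-- `max_{|z| ≤ 1} |P(z)|`; the supremum is attained since the closed disk is compact. -/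
def maxModulus (P : ℝ[X]) : ℝ :=
  sSup ((fun z : ℂ => ‖aeval z P‖) '' Metric.closedBall 0 1)

/-- The quotient `|P(e^{iπ/T})| / P(1)`. -/
def angularRatio (T : ℕ) (P : ℝ[X]) : ℝ :=
  ‖aeval (Complex.exp (Complex.I * Real.pi / T)) P‖ / P.eval 1

end

/-!
Write `α = π / (2 + 2T)`. A local homeomorphism of the disk that is injective on every circle
centred at the origin is injective. For a trinomial, two points `z e^(it)` and `z e^(-it)` of a
circle have the same image iff `w = z^T` is a zero of the real quadratic
`sin t + x sin ((1 + T)t) w + y sin ((1 + 2T)t) w²`, and real quadratics without zeros in the unit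
disk are described by linear inequalities between their coefficients. Hence (Dieudonné's criterion)
the trinomial is univalent iff, for all `0 < t < π`,
`|y sin ((1 + 2T)t)| ≤ sin t` and `|x sin ((1 + T)t)| ≤ sin t + y sin ((1 + 2T)t)`; critical points
are excluded by dividing by `t` and letting `t → 0`.

At `t → 0` the first condition gives `|y| ≤ 1 / (1 + 2T)`, and at `t = α` the second one gives
`|x| ≤ sin α (1 + y)`. If equality holds in the latter, then `t = α` is a local minimum of
`sin t + y sin ((1 + 2T)t) - |x| sin ((1 + T)t)`, and the vanishing derivative forces
`y = 1 / (1 + 2T)`. All extremal statements are read off from this region of coefficients.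
-/

section InjectivityOnBalls

open Set Filter Topology

theorem isClosed_setOf_eq_and_ne {X Y : Type*} [TopologicalSpace X] [TopologicalSpace Y] [T2Space Y]
    {f : X → Y} {s : Set X} (hs : IsClosed s) (hf : ContinuousOn f s)
    (hinj : ∀ x ∈ s, ∃ U ∈ 𝓝 x, InjOn f U) :
    IsClosed {p : X × X | p ∈ s ×ˢ s ∧ f p.1 = f p.2 ∧ p.1 ≠ p.2} := by
  have hclosed : IsClosed (s ×ˢ s ∩ Prod.map f f ⁻¹' diagonal Y) :=
    (hf.prodMap hf).preimage_isClosed_of_isClosed (hs.prod hs) isClosed_diagonal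
  refine isClosed_of_closure_subset fun p hp => ?_
  obtain ⟨hps, hpf⟩ :=
    closure_minimal (fun q hq => (⟨hq.1, hq.2.1⟩ : _ ∧ f q.1 = f q.2)) hclosed hp
  refine ⟨hps, hpf, fun hpe => ?_⟩
  obtain ⟨U, hU, hUinj⟩ := hinj p.1 hps.1
  have hUU : U ×ˢ U ∈ 𝓝 p := prod_mem_nhds hU (hpe ▸ hU)
  obtain ⟨q, ⟨hq1, hq2⟩, -, hqf, hqne⟩ := mem_closure_iff_nhds.1 hp _ hUU
  exact hqne (hUinj hq1 hq2 hqf)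

theorem exists_eq_and_norm_lt {E Y : Type*} [NormedAddCommGroup E] [NormedSpace ℝ E]
    [TopologicalSpace Y] {f : E → Y} {u v : E} (hu : 𝓝 (f u) ≤ map f (𝓝 u))
    (hv : ContinuousAt f v) (huv : f u = f v) (hlt : ‖u‖ < ‖v‖) :
    ∃ z w, f z = f w ∧ ‖z‖ < ‖w‖ ∧ ‖w‖ < ‖v‖ := by
  obtain ⟨m, hum, hmv⟩ := exists_between hlt
  have himage : f '' Metric.ball 0 m ∈ 𝓝 (f v) :=
    huv ▸ hu (image_mem_map (Metric.isOpen_ball.mem_nhds (mem_ball_zero_iff.2 hum)))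
  have hnear : ∀ᶠ w in 𝓝 v, f w ∈ f '' Metric.ball 0 m ∧ m < ‖w‖ :=
    (hv.eventually_mem himage).and (continuous_norm.continuousAt.eventually_const_lt hmv)
  have hclosure : v ∈ closure (Metric.ball (0 : E) ‖v‖) := by
    rw [closure_ball _ ((norm_nonneg u).trans_lt hlt).ne']
    exact mem_closedBall_zero_iff.2 le_rfl
  obtain ⟨w, hwv, ⟨z, hzm, hzw⟩, hmw⟩ :=
    ((mem_closure_iff_frequently.1 hclosure).and_eventually hnear).exists
  exact ⟨z, w, hzw, (mem_ball_zero_iff.1 hzm).trans hmw, mem_ball_zero_iff.1 hwv⟩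

-- Among the pairs `u ≠ v` with `f u = f v` and `‖u‖ ≤ ‖v‖ ≤ ‖b‖`, compactness provides one with
-- `‖v‖` minimal. If `‖u‖ < ‖v‖`, openness of `f` at `u` allows `v` to be moved inwards.
theorem injOn_ball_of_isLocalHomeomorphOn {E Y : Type*} [NormedAddCommGroup E] [NormedSpace ℝ E]
    [ProperSpace E] [TopologicalSpace Y] [T2Space Y] {f : E → Y} {r : ℝ}
    (hf : IsLocalHomeomorphOn f (Metric.ball 0 r))
    (hsphere : ∀ ρ ∈ Ioo 0 r, InjOn f (Metric.sphere 0 ρ)) : InjOn f (Metric.ball 0 r) := by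
  intro a ha b hb hab
  by_contra hne
  wlog hle : ‖a‖ ≤ ‖b‖ generalizing a b
  · exact this hb ha hab.symm (Ne.symm hne) (le_of_not_ge hle)
  set B := Metric.closedBall (0 : E) ‖b‖
  have hBr : B ⊆ Metric.ball 0 r := Metric.closedBall_subset_ball (mem_ball_zero_iff.1 hb)
  set K : Set (E × E) := {p | p ∈ B ×ˢ B ∧ f p.1 = f p.2 ∧ p.1 ≠ p.2} ∩ {p | ‖p.1‖ ≤ ‖p.2‖}
  have hinj : ∀ z ∈ B, ∃ U ∈ 𝓝 z, InjOn f U := fun z hz => by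
    obtain ⟨e, hze, rfl⟩ := hf z (hBr hz)
    exact ⟨e.source, e.open_source.mem_nhds hze, e.injOn⟩
  have hKclosed : IsClosed K :=
    (isClosed_setOf_eq_and_ne Metric.isClosed_closedBall (hf.continuousOn.mono hBr) hinj).inter
      (isClosed_le continuous_fst.norm continuous_snd.norm)
  have hKcompact : IsCompact K :=
    ((isCompact_closedBall 0 ‖b‖).prod (isCompact_closedBall 0 ‖b‖)).of_isClosed_subset hKclosed
      fun p hp => hp.1.1
  have hab_mem : (a, b) ∈ K := ⟨⟨⟨by simpa [B] using hle, by simp [B]⟩, hab, hne⟩, hle⟩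
  obtain ⟨⟨u, v⟩, ⟨⟨⟨hu, hv⟩, huv, hne'⟩, hle'⟩, hmin⟩ :=
    hKcompact.exists_isMinOn ⟨_, hab_mem⟩ continuous_snd.norm.continuousOn
  rcases lt_or_eq_of_le (show ‖u‖ ≤ ‖v‖ from hle') with hlt | heq
  · obtain ⟨z, w, hzw, hz, hw⟩ := exists_eq_and_norm_lt (hf.map_nhds_eq (hBr hu)).ge
      (hf.continuousAt (hBr hv)) huv hlt
    have hwb : ‖w‖ ≤ ‖b‖ := hw.le.trans (mem_closedBall_zero_iff.1 hv)
    have hzw_mem : (z, w) ∈ K :=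
      ⟨⟨⟨mem_closedBall_zero_iff.2 (hz.le.trans hwb), mem_closedBall_zero_iff.2 hwb⟩, hzw,
        fun h => hz.ne (congrArg norm h)⟩, hz.le⟩
    exact (hmin hzw_mem).not_gt hw
  · have hv0 : 0 < ‖v‖ := norm_pos_iff.2 fun hv0 =>
      hne' ((norm_eq_zero.1 (heq.trans (hv0 ▸ norm_zero))).trans hv0.symm)
    exact hne' (hsphere ‖v‖ ⟨hv0, mem_ball_zero_iff.1 (hBr hv)⟩ (mem_sphere_zero_iff_norm.2 heq)
      (mem_sphere_zero_iff_norm.2 rfl) huv)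

theorem isLocalHomeomorphOn_of_hasStrictDerivAt {𝕜 : Type*} [NontriviallyNormedField 𝕜]
    [CompleteSpace 𝕜] {f f' : 𝕜 → 𝕜} {s : Set 𝕜} (hf : ∀ z ∈ s, HasStrictDerivAt f (f' z) z)
    (hf' : ∀ z ∈ s, f' z ≠ 0) : IsLocalHomeomorphOn f s :=
  fun z hz =>
    let hequiv := (hf z hz).hasStrictFDerivAt_equiv (hf' z hz)
    ⟨hequiv.toOpenPartialHomeomorph f, hequiv.mem_toOpenPartialHomeomorph_source,
      (hequiv.toOpenPartialHomeomorph_coe).symm⟩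

end InjectivityOnBalls

section Circles

open Complex Set

theorem exists_mul_exp_eq_of_norm_eq {u v : ℂ} (h : ‖u‖ = ‖v‖) (hne : u ≠ v) :
    ∃ z : ℂ, ∃ t ∈ Ioo 0 Real.pi, u = z * exp (t * I) ∧ v = z * exp (-(t * I)) := by
  have hv : v ≠ 0 := fun hv => hne (by simp_all)
  set φ := (-(u / v)).arg
  set t := (φ + Real.pi) / 2 with ht
  have hnorm : ‖-(u / v)‖ = 1 := by rw [norm_neg, norm_div, h, div_self (norm_ne_zero_iff.2 hv)]
  have hu : u = v * exp (t * I) * exp (t * I) := by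
    have hexp : exp (φ * I) = -(u / v) := by
      simpa only [hnorm, ofReal_one, one_mul] using norm_mul_exp_arg_mul_I (-(u / v))
    rw [mul_assoc, ← exp_add, show (t * I + t * I : ℂ) = φ * I + Real.pi * I by
      rw [ht]; push_cast; ring, exp_add, hexp, exp_pi_mul_I]
    field_simp
  have htπ : t ≠ Real.pi := fun h => hne <| by
    rw [hu, mul_assoc, ← exp_add, h, ← two_mul, ← mul_assoc, exp_two_pi_mul_I, mul_one]
  refine ⟨v * exp (t * I), t, ⟨?_, lt_of_le_of_ne ?_ htπ⟩, hu, ?_⟩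
  · linarith [neg_pi_lt_arg (-(u / v))]
  · linarith [arg_le_pi (-(u / v))]
  · rw [mul_assoc, ← exp_add, add_neg_cancel, exp_zero, mul_one]

theorem exp_mul_I_ne_exp_neg_mul_I {t : ℝ} (ht : t ∈ Ioo 0 Real.pi) :
    exp (t * I) ≠ exp (-(t * I)) := fun h => by
  have hsin : sin (t : ℂ) = 0 := by rw [sin, neg_mul, h, sub_self, zero_mul, zero_div]
  exact (Real.sin_pos_of_mem_Ioo ht).ne' (by exact_mod_cast hsin)

theorem injOn_sphere_iff_forall_mul_exp_ne {Y : Type*} {f : ℂ → Y} {r : ℝ} (hr : 0 < r) :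
    InjOn f (Metric.sphere 0 r) ↔
      ∀ t ∈ Ioo 0 Real.pi, ∀ z : ℂ, ‖z‖ = r → f (z * exp (t * I)) ≠ f (z * exp (-(t * I))) := by
  have hrot (z : ℂ) (t : ℝ) : ‖z * exp (t * I)‖ = ‖z‖ ∧ ‖z * exp (-(t * I))‖ = ‖z‖ := by
    rw [← neg_mul, ← ofReal_neg, norm_mul, norm_mul, norm_exp_ofReal_mul_I, norm_exp_ofReal_mul_I,
      mul_one]
    exact ⟨rfl, rfl⟩
  simp only [InjOn, mem_sphere_zero_iff_norm]
  constructor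
  · intro h t ht z hz heq
    have hz0 : z ≠ 0 := norm_pos_iff.1 (hz ▸ hr)
    exact exp_mul_I_ne_exp_neg_mul_I ht <|
      mul_left_cancel₀ hz0 (h ((hrot z t).1.trans hz) ((hrot z t).2.trans hz) heq)
  · intro h u hu v hv huv
    by_contra hne
    obtain ⟨z, t, ht, rfl, rfl⟩ := exists_mul_exp_eq_of_norm_eq (hu.trans hv.symm) hne
    exact h t ht z ((hrot z t).1.symm.trans hu) huv

end Circles

section Quadratics

theorem real_quadratic_ne_zero {a b c : ℝ} (hc : |c| ≤ a) (hb : |b| ≤ a + c) (ha : 0 < a) {w : ℂ}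
    (hw : ‖w‖ < 1) : a + b * w + c * w ^ 2 ≠ 0 := by
  intro h
  obtain ⟨p, q⟩ := w
  have hre : a + b * p + c * (p ^ 2 - q ^ 2) = 0 := by
    simpa [pow_two] using congrArg Complex.re h
  have him : q * (b + 2 * c * p) = 0 := by
    have := congrArg Complex.im h
    simp only [pow_two, Complex.add_im, Complex.mul_im, Complex.ofReal_im, Complex.ofReal_re,
      Complex.zero_im] at this
    linarith
  have hpq : p ^ 2 + q ^ 2 < 1 := by
    have := pow_lt_one₀ (norm_nonneg _) hw two_ne_zero
    rwa [Complex.sq_norm, Complex.normSq_mk, ← pow_two, ← pow_two] at this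
  rcases mul_eq_zero.1 him with rfl | hb'
  · have hp : |p| < 1 := by rw [← sq_lt_one_iff_abs_lt_one]; linarith
    have hbp : -((a + c) * |p|) ≤ b * p := by
      rw [neg_le]
      calc -(b * p) ≤ |b| * |p| := (neg_le_abs _).trans_eq (abs_mul b p)
        _ ≤ (a + c) * |p| := by gcongr
    have hcp : c * |p| < a :=
      (mul_le_mul_of_nonneg_right ((le_abs_self c).trans hc) (abs_nonneg p)).trans_lt
        (mul_lt_of_lt_one_right ha hp)
    have hpos : 0 < (1 - |p|) * (a - c * |p|) := mul_pos (sub_pos.2 hp) (sub_pos.2 hcp)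
    have hsq : (1 - |p|) * (a - c * |p|) = a - (a + c) * |p| + c * p ^ 2 := by
      rw [← sq_abs p]; ring
    linarith
  · have hprod : a = c * (p ^ 2 + q ^ 2) := by
      linear_combination hre - p * hb'
    nlinarith [le_abs_self c, sq_nonneg p, sq_nonneg q]

theorem exists_norm_lt_one_quadratic_eq_zero {a b c : ℂ} (h : ‖a‖ < ‖c‖) :
    ∃ w : ℂ, ‖w‖ < 1 ∧ a + b * w + c * w ^ 2 = 0 := by
  have hc : c ≠ 0 := norm_pos_iff.1 ((norm_nonneg a).trans_lt h)
  obtain ⟨u, hu⟩ := exists_quadratic_eq_zero (a := 1) (b := b / c) (c := a / c) one_ne_zero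
    (IsAlgClosed.exists_eq_mul_self _)
  obtain ⟨v, hv, -, huv⟩ := vieta_formula_quadratic (b := -(b / c)) (c := a / c) (x := u)
    (by linear_combination hu)
  have hroot {w : ℂ} (hw : w * w - -(b / c) * w + a / c = 0) : a + b * w + c * w ^ 2 = 0 := by
    field_simp at hw
    linear_combination hw
  have hprod : ‖u‖ * ‖v‖ < 1 := by
    rw [← norm_mul, huv, norm_div]
    exact (div_lt_one (norm_pos_iff.2 hc)).2 h
  rcases lt_or_ge ‖u‖ 1 with hu1 | hu1
  · exact ⟨u, hu1, hroot (by linear_combination hu)⟩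
  · exact ⟨v, by nlinarith [norm_nonneg v], hroot hv⟩

theorem exists_abs_lt_one_quadratic_eq_zero {a b c : ℝ} (ha : 0 < a) (h : a + c < |b|) :
    ∃ r : ℝ, |r| < 1 ∧ a + b * r + c * r ^ 2 = 0 := by
  wlog hb : 0 ≤ b generalizing b
  · obtain ⟨r, hr, hroot⟩ := this (b := -b) (by rwa [abs_neg]) (by linarith)
    exact ⟨-r, by rwa [abs_neg], by linear_combination hroot⟩
  rw [abs_of_nonneg hb] at h
  have hcont : Continuous fun r : ℝ => a + b * r + c * r ^ 2 := by fun_prop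
  obtain ⟨r, hr, hroot⟩ := intermediate_value_Ioo (by norm_num : (-1 : ℝ) ≤ 0) hcont.continuousOn
    (show (0 : ℝ) ∈ Set.Ioo _ _ by constructor <;> linarith)
  exact ⟨r, abs_lt.2 ⟨hr.1, hr.2.trans one_pos⟩, hroot⟩

theorem forall_real_quadratic_ne_zero_iff {a b c : ℝ} (ha : 0 < a) :
    (∀ w : ℂ, ‖w‖ < 1 → a + b * w + c * w ^ 2 ≠ 0) ↔ |c| ≤ a ∧ |b| ≤ a + c := by
  refine ⟨fun h => ⟨?_, ?_⟩, fun h w => real_quadratic_ne_zero h.1 h.2 ha⟩ <;> by_contra! hlt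
  · obtain ⟨w, hw, hroot⟩ := exists_norm_lt_one_quadratic_eq_zero (a := a) (b := b) (c := c)
      (by rwa [Complex.norm_of_nonneg ha.le, Complex.norm_real])
    exact h w hw hroot
  · obtain ⟨r, hr, hroot⟩ := exists_abs_lt_one_quadratic_eq_zero ha hlt
    exact h r (by rwa [Complex.norm_real]) (by exact_mod_cast hroot)

end Quadratics

section TrigonometricInequality

open Real Set

theorem abs_sin_natCast_mul_le (n : ℕ) (t : ℝ) : |sin (n * t)| ≤ n * |sin t| := by
  induction n with
  | zero => simp
  | succ n ih =>
    calc |sin ((n + 1 : ℕ) * t)| = |sin (n * t) * cos t + cos (n * t) * sin t| := by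
          rw [Nat.cast_succ, add_mul, one_mul, sin_add]
      _ ≤ |sin (n * t)| * |cos t| + |cos (n * t)| * |sin t| := by
          rw [← abs_mul, ← abs_mul]; exact abs_add_le _ _
      _ ≤ n * |sin t| * 1 + 1 * |sin t| := by
          gcongr
          exacts [abs_cos_le_one t, abs_cos_le_one _]
      _ = (n + 1 : ℕ) * |sin t| := by push_cast; ring

theorem abs_sin_one_add_two_mul_le (T : ℕ) {t : ℝ} (ht : t ∈ Icc 0 π) :
    |sin ((1 + 2 * T) * t)| ≤ (1 + 2 * T) * sin t := by
  have h := abs_sin_natCast_mul_le (1 + 2 * T) t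
  rw [abs_of_nonneg (sin_nonneg_of_mem_Icc ht)] at h
  exact_mod_cast h

/-- The angle `π / (2 + 2T)`, whose sine governs the middle coefficient of `S^(T)`. -/
noncomputable def suffridgeAngle (T : ℕ) : ℝ := π / (2 + 2 * T)

theorem one_add_mul_suffridgeAngle (T : ℕ) : (1 + T) * suffridgeAngle T = π / 2 := by
  rw [suffridgeAngle]; field_simp

theorem one_add_two_mul_mul_suffridgeAngle (T : ℕ) :
    (1 + 2 * T) * suffridgeAngle T = π - suffridgeAngle T := by
  linear_combination 2 * one_add_mul_suffridgeAngle T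

theorem suffridgeAngle_pos (T : ℕ) : 0 < suffridgeAngle T := by
  rw [suffridgeAngle]; positivity

theorem suffridgeAngle_le (T : ℕ) : suffridgeAngle T ≤ π / 2 := by
  nlinarith [one_add_mul_suffridgeAngle T, suffridgeAngle_pos T, Nat.cast_nonneg (α := ℝ) T]

theorem suffridgeAngle_mem_Ioo (T : ℕ) : suffridgeAngle T ∈ Ioo 0 π :=
  ⟨suffridgeAngle_pos T, by linarith [suffridgeAngle_le T, pi_pos]⟩

theorem hasDerivAt_sin_const_mul (m t : ℝ) :
    HasDerivAt (fun t => sin (m * t)) (m * cos (m * t)) t := by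
  simpa [mul_comm] using ((hasDerivAt_id t).const_mul m).sin

theorem hasDerivAt_sin_div_sin_add_cos (T t : ℝ) (h : sin ((1 + T) * t) ≠ 0) :
    HasDerivAt (fun t => T * (sin t / sin ((1 + T) * t)) + cos (T * t))
      (-(T * cos ((1 + T) * t) / sin ((1 + T) * t) ^ 2 *
        ((1 + 2 * T) * sin t - sin ((1 + 2 * T) * t)) / 2)) t := by
  have hcos : HasDerivAt (fun t => cos (T * t)) (-sin (T * t) * T) t := by
    simpa using ((hasDerivAt_id t).const_mul T).cos
  refine ((((hasDerivAt_sin t).div (hasDerivAt_sin_const_mul (1 + T) t) h).const_mul T).add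
    hcos).congr_deriv ?_
  have hsinT : sin (T * t) = sin ((1 + T) * t) * cos t - cos ((1 + T) * t) * sin t := by
    rw [← sin_sub]; congr 1; ring
  have hsin2T : sin ((1 + 2 * T) * t) = 2 * sin ((1 + T) * t) * (cos ((1 + T) * t) *
      cos t + sin ((1 + T) * t) * sin t) - sin t := by
    rw [show (1 + 2 * T) * t = 2 * ((1 + T) * t) - t by ring, sin_sub, sin_two_mul, cos_two_mul']
    linear_combination (-sin t) * sin_sq_add_cos_sq ((1 + T) * t)
  rw [hsinT, hsin2T]
  field_simp
  linear_combination (-2 * sin ((1 + T) * t) * cos t * T) * sin_sq_add_cos_sq ((1 + T) * t)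

-- The function is half of `((1 + 2T) sin t + sin ((1 + 2T)t)) / sin ((1 + T)t)`.
theorem isMinOn_sin_div_sin_add_cos (T : ℕ) :
    IsMinOn (fun t : ℝ => T * (sin t / sin ((1 + T) * t)) + cos (T * t))
      (Ioo 0 (π / (1 + T))) (suffridgeAngle T) := by
  set α := suffridgeAngle T
  have hT : (0 : ℝ) < 1 + T := by positivity
  have hα : (1 + T) * α = π / 2 := one_add_mul_suffridgeAngle T
  have hα0 : 0 < α := suffridgeAngle_pos T
  have hαπ : α < π / (1 + T) := by rw [lt_div_iff₀' hT, hα]; linarith [pi_pos]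
  have hderiv {t : ℝ} (ht : t ∈ Ioo 0 (π / (1 + T))) :=
    hasDerivAt_sin_div_sin_add_cos T t
      (sin_pos_of_pos_of_lt_pi (mul_pos hT ht.1) ((lt_div_iff₀' hT).1 ht.2)).ne'
  have hfactor {t : ℝ} (ht : t ∈ Ioo 0 (π / (1 + T))) :
      0 ≤ (1 + 2 * T) * sin t - sin ((1 + 2 * T) * t) := by
    have htπ : t ≤ π := ht.2.le.trans (div_le_self pi_pos.le (by linarith [T.cast_nonneg (α := ℝ)]))
    linarith [(abs_le.1 (abs_sin_one_add_two_mul_le T ⟨ht.1.le, htπ⟩)).2]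
  have hleft : Ioo 0 α ⊆ Ioo 0 (π / (1 + T)) := Ioo_subset_Ioo_right hαπ.le
  have hright : Ioo α (π / (1 + T)) ⊆ Ioo 0 (π / (1 + T)) := Ioo_subset_Ioo_left hα0.le
  refine isMinOn_Ioo_of_deriv (hderiv ⟨hα0, hαπ⟩).continuousAt
    (fun t ht => (hderiv (hleft ht)).differentiableAt.differentiableWithinAt)
    (fun t ht => (hderiv (hright ht)).differentiableAt.differentiableWithinAt)
    (fun t ht => ?_) fun t ht => ?_
  · have hcos : 0 ≤ cos ((1 + T) * t) := by
      have := mul_lt_mul_of_pos_left ht.2 hT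
      exact cos_nonneg_of_mem_Icc ⟨by linarith [mul_pos hT ht.1, pi_pos], by linarith⟩
    have := hfactor (hleft ht)
    rw [(hderiv (hleft ht)).deriv, neg_nonpos]
    positivity
  · have hcos : 0 ≤ -cos ((1 + T) * t) := by
      have h1 := mul_lt_mul_of_pos_left ht.1 hT
      have h2 := (lt_div_iff₀' hT).1 ht.2
      exact neg_nonneg.2 (cos_nonpos_of_pi_div_two_le_of_le (by linarith) (by linarith))
    have := hfactor (hright ht)
    rw [(hderiv (hright ht)).deriv, ← neg_div, ← neg_mul, ← neg_div, ← mul_neg]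
    positivity

theorem mul_abs_sin_one_add_mul_le_of_mem_Icc {T : ℕ} {t : ℝ} (ht : t ∈ Icc 0 (π / (1 + T))) :
    2 * (1 + T) * sin (suffridgeAngle T) * |sin ((1 + T) * t)| ≤
      (1 + 2 * T) * sin t + sin ((1 + 2 * T) * t) := by
  have hT : (0 : ℝ) < 1 + T := by positivity
  have hπ : (1 + T) * t ≤ π := (le_div_iff₀' hT).1 ht.2
  rcases (sin_nonneg_of_nonneg_of_le_pi (mul_nonneg hT.le ht.1) hπ).eq_or_lt with h0 | hpos
  · have htπ : t ≤ π := ht.2.trans (div_le_self pi_pos.le (by linarith [T.cast_nonneg (α := ℝ)]))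
    rw [← h0, abs_zero, mul_zero]
    linarith [(abs_le.1 (abs_sin_one_add_two_mul_le T ⟨ht.1, htπ⟩)).1]
  · have htIoo : t ∈ Ioo 0 (π / (1 + T)) := by
      refine ⟨ht.1.lt_of_ne' ?_, ht.2.lt_of_ne ?_⟩ <;> rintro rfl
      · simp at hpos
      · rw [mul_div_cancel₀ _ hT.ne', sin_pi] at hpos
        exact hpos.false
    have hmin : (1 + T) * sin (suffridgeAngle T) ≤ T * (sin t / sin ((1 + T) * t)) + cos (T * t) :=
      calc (1 + T) * sin (suffridgeAngle T)
          = T * (sin (suffridgeAngle T) / sin ((1 + T) * suffridgeAngle T)) +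
              cos (T * suffridgeAngle T) := by
            rw [show T * suffridgeAngle T = π / 2 - suffridgeAngle T by
              linear_combination one_add_mul_suffridgeAngle T, one_add_mul_suffridgeAngle,
              sin_pi_div_two, cos_pi_div_two_sub]
            ring
        _ ≤ _ := isMinOn_sin_div_sin_add_cos T htIoo
    have hsum : sin ((1 + 2 * T) * t) + sin t = 2 * sin ((1 + T) * t) * cos (T * t) := by
      rw [sin_add_sin]; congr 3 <;> ring
    calc 2 * (1 + T) * sin (suffridgeAngle T) * |sin ((1 + T) * t)|
        = 2 * ((1 + T) * sin (suffridgeAngle T)) * sin ((1 + T) * t) := by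
          rw [abs_of_pos hpos, mul_assoc 2 (1 + (T : ℝ))]
      _ ≤ 2 * (T * (sin t / sin ((1 + T) * t)) + cos (T * t)) * sin ((1 + T) * t) := by gcongr
      _ = 2 * T * sin t + 2 * sin ((1 + T) * t) * cos (T * t) := by field_simp
      _ = (1 + 2 * T) * sin t + sin ((1 + 2 * T) * t) := by rw [← hsum]; ring

theorem le_sinusoid_of_le_of_le {a b m u t v : ℝ} (hut : u ≤ t) (htv : t ≤ v) (huv : v - u < π)
    (hm : 0 ≤ m) (hu : m ≤ a * sin u + b * cos u) (hv : m ≤ a * sin v + b * cos v) :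
    m ≤ a * sin t + b * cos t := by
  rcases hut.eq_or_lt with rfl | hlt
  · exact hu
  have hsin : 0 < sin (v - u) := sin_pos_of_pos_of_lt_pi (by linarith) huv
  have hleft : 0 ≤ sin (t - u) := sin_nonneg_of_nonneg_of_le_pi (by linarith) (by linarith)
  have hright : 0 ≤ sin (v - t) := sin_nonneg_of_nonneg_of_le_pi (by linarith) (by linarith)
  have hsubadd : sin (v - u) ≤ sin (v - t) + sin (t - u) := by
    rw [← sub_add_sub_cancel v t u, sin_add]
    nlinarith [cos_le_one (v - t), cos_le_one (t - u)]
  refine le_of_mul_le_mul_left ?_ hsin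
  calc sin (v - u) * m ≤ (sin (v - t) + sin (t - u)) * m := by gcongr
    _ = sin (v - t) * m + sin (t - u) * m := add_mul _ _ _
    _ ≤ sin (v - t) * (a * sin u + b * cos u) + sin (t - u) * (a * sin v + b * cos v) := by gcongr
    _ = sin (v - u) * (a * sin t + b * cos t) := by
      simp only [sin_sub]
      ring

-- Shifting `t` by multiples of `π / (1 + T)` preserves both `|sin ((1 + T)t)|` and the phase
-- `2(1 + T)t` modulo `2π`, so along such shifts the right-hand side is a sinusoid of period `2π`.
-- A sinusoid above a nonnegative level at the two ends of an interval shorter than `π` stays above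
-- it in between; thus the first and the last arch of `|sin ((1 + T)t)|` control the others.
theorem mul_abs_sin_one_add_mul_le_add_int_mul_iff (T : ℕ) (t : ℝ) (j : ℤ) :
    2 * (1 + T) * sin (suffridgeAngle T) * |sin ((1 + T) * (t + j * (π / (1 + T))))| ≤
        (1 + 2 * T) * sin (t + j * (π / (1 + T))) +
          sin ((1 + 2 * T) * (t + j * (π / (1 + T)))) ↔
      2 * (1 + T) * sin (suffridgeAngle T) * |sin ((1 + T) * t)| ≤
        (1 + 2 * T - cos (2 * (1 + T) * t)) * sin (t + j * (π / (1 + T))) +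
          sin (2 * (1 + T) * t) * cos (t + j * (π / (1 + T))) := by
  set s := t + j * (π / (1 + T)) with hs
  have hshift : (1 + T) * s = (1 + T) * t + j * π := by rw [hs]; field_simp
  have habs : |sin ((1 + T) * s)| = |sin ((1 + T) * t)| := by
    rw [hshift, sin_add_int_mul_pi, abs_mul, abs_neg_one_zpow, one_mul]
  have hphase : sin ((1 + 2 * T) * s) =
      sin (2 * (1 + T) * t) * cos s - cos (2 * (1 + T) * t) * sin s := by
    rw [← sin_sub, ← sin_add_int_mul_two_pi (2 * (1 + T) * t - s) j]
    congr 1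
    linear_combination 2 * hshift
  rw [habs, hphase]
  ring_nf

theorem mul_abs_sin_one_add_mul_le_pi_sub_iff (T : ℕ) (t : ℝ) :
    2 * (1 + T) * sin (suffridgeAngle T) * |sin ((1 + T) * (π - t))| ≤
        (1 + 2 * T) * sin (π - t) + sin ((1 + 2 * T) * (π - t)) ↔
      2 * (1 + T) * sin (suffridgeAngle T) * |sin ((1 + T) * t)| ≤
        (1 + 2 * T) * sin t + sin ((1 + 2 * T) * t) := by
  have habs : |sin ((1 + T) * (π - t))| = |sin ((1 + T) * t)| := by
    have h := sin_nat_mul_pi_sub ((1 + T) * t) (1 + T)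
    push_cast at h
    rw [mul_sub, h, abs_neg, abs_mul, abs_neg_one_pow, one_mul]
  have hsin : sin ((1 + 2 * T) * (π - t)) = sin ((1 + 2 * T) * t) := by
    have h := sin_nat_mul_pi_sub ((1 + 2 * T) * t) (1 + 2 * T)
    push_cast at h
    rw [mul_sub, h, Odd.neg_one_pow ⟨T, add_comm 1 (2 * T)⟩]
    ring
  rw [habs, hsin, sin_pi_sub]

theorem mul_abs_sin_one_add_mul_le {T : ℕ} {t : ℝ} (ht : t ∈ Ioo 0 π) :
    2 * (1 + T) * sin (suffridgeAngle T) * |sin ((1 + T) * t)| ≤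
      (1 + 2 * T) * sin t + sin ((1 + 2 * T) * t) := by
  have hiff := mul_abs_sin_one_add_mul_le_add_int_mul_iff T t
  have hfirst {s : ℝ} := mul_abs_sin_one_add_mul_le_of_mem_Icc (T := T) (t := s)
  have hδ : 0 < π / (1 + T) := by positivity
  have hπ : π = (1 + T) * (π / (1 + T)) := by field_simp
  set δ := π / (1 + T)
  obtain ⟨k, hk, hk'⟩ : ∃ k : ℕ, k * δ ≤ t ∧ t < (k + 1) * δ :=
    ⟨⌊t / δ⌋₊, (le_div_iff₀ hδ).1 (Nat.floor_le (div_pos ht.1 hδ).le),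
      (div_lt_iff₀ hδ).1 (Nat.lt_floor_add_one _)⟩
  have hkT : k ≤ (T : ℝ) := by
    have : (k : ℝ) < 1 + T := lt_of_mul_lt_mul_right (by linarith [ht.2]) hδ.le
    exact_mod_cast Nat.lt_one_add_iff.1 (by exact_mod_cast this)
  have hu := (hiff (-k)).1 (hfirst ⟨by push_cast; linarith, by push_cast; linarith⟩)
  have hv := (hiff (T - k)).1 <| (mul_abs_sin_one_add_mul_le_pi_sub_iff T _).1 <|
    hfirst ⟨by push_cast; linarith, by push_cast; linarith⟩
  have hzero := hiff 0
  rw [Int.cast_zero, zero_mul, add_zero] at hzero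
  refine hzero.2 (le_sinusoid_of_le_of_le ?_ ?_ ?_ ?_ hu hv)
  · push_cast; nlinarith
  · push_cast; nlinarith
  · push_cast; linarith
  · have := sin_pos_of_mem_Ioo (suffridgeAngle_mem_Ioo T)
    positivity

end TrigonometricInequality

section DerivativeComparison

open Set Filter Topology

theorem norm_le_of_eventually_norm_sub_le {E : Type*} [NormedAddCommGroup E] [NormedSpace ℝ E]
    {u : ℝ → E} {v : ℝ → ℝ} {u' : E} {v' a : ℝ} (hu : HasDerivWithinAt u u' (Ioi a) a)
    (hv : HasDerivWithinAt v v' (Ioi a) a)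
    (h : ∀ᶠ t in 𝓝[>] a, ‖u t - u a‖ ≤ v t - v a) : ‖u'‖ ≤ v' := by
  rw [hasDerivWithinAt_iff_tendsto_slope' self_notMem_Ioi] at hu hv
  refine le_of_tendsto_of_tendsto hu.norm hv ?_
  filter_upwards [h, self_mem_nhdsWithin] with t ht hat
  have hpos : 0 < t - a := sub_pos.2 hat
  rw [slope_def_module, slope_def_field, norm_smul, norm_inv, Real.norm_of_nonneg hpos.le,
    inv_mul_eq_div]
  gcongr

end DerivativeComparison

section DieudonneCriterion

open Complex Set

theorem aeval_trinomialT (T : ℕ) (x y : ℝ) (z : ℂ) :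
    aeval z (trinomialT T x y) = z + x * z ^ (1 + T) + y * z ^ (1 + 2 * T) := by
  simp [trinomialT]

theorem aeval_derivative_trinomialT (T : ℕ) (x y : ℝ) (z : ℂ) :
    aeval z (derivative (trinomialT T x y)) =
      (1 : ℝ) + ((1 + T) * x : ℝ) * z ^ T + ((1 + 2 * T) * y : ℝ) * (z ^ T) ^ 2 := by
  simp only [trinomialT, derivative_X, derivative_C_mul_X_pow, map_add, map_one, map_mul, map_pow,
    aeval_X, aeval_C, add_tsub_cancel_left, coe_algebraMap]
  push_cast
  ring

theorem exp_mul_I_pow_sub_exp_neg_mul_I_pow (n : ℕ) (t : ℝ) :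
    exp (t * I) ^ n - exp (-(t * I)) ^ n = 2 * I * Real.sin (n * t) := by
  rw [← exp_nat_mul, ← exp_nat_mul, ofReal_sin, sin]
  push_cast
  rw [show (n : ℂ) * (t * I) = n * t * I by ring, show (n : ℂ) * -(t * I) = -(n * t) * I by ring]
  linear_combination (exp (n * t * I) - exp (-(n * t) * I)) * I_sq

theorem aeval_trinomialT_mul_exp_sub (T : ℕ) (x y t : ℝ) (z : ℂ) :
    aeval (z * exp (t * I)) (trinomialT T x y) - aeval (z * exp (-(t * I))) (trinomialT T x y) =
      2 * I * z * (Real.sin t + (x * Real.sin ((1 + T) * t) : ℝ) * z ^ T +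
        (y * Real.sin ((1 + 2 * T) * t) : ℝ) * (z ^ T) ^ 2) := by
  have hbottom := exp_mul_I_pow_sub_exp_neg_mul_I_pow 1 t
  have hmiddle := exp_mul_I_pow_sub_exp_neg_mul_I_pow (1 + T) t
  have htop := exp_mul_I_pow_sub_exp_neg_mul_I_pow (1 + 2 * T) t
  push_cast at hbottom hmiddle htop
  rw [pow_one, pow_one, one_mul] at hbottom
  simp only [aeval_trinomialT, mul_pow]
  push_cast
  linear_combination z * hbottom + x * z ^ (1 + T) * hmiddle + y * z ^ (1 + 2 * T) * htop

variable {T : ℕ} {x y : ℝ}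

theorem forall_aeval_trinomialT_mul_exp_ne_iff (hT : T ≠ 0) {t : ℝ} (ht : t ∈ Ioo 0 Real.pi) :
    (∀ r ∈ Ioo (0 : ℝ) 1, ∀ z : ℂ, ‖z‖ = r → aeval (z * exp (t * I)) (trinomialT T x y) ≠
        aeval (z * exp (-(t * I))) (trinomialT T x y)) ↔
      |y * Real.sin ((1 + 2 * T) * t)| ≤ Real.sin t ∧
        |x * Real.sin ((1 + T) * t)| ≤ Real.sin t + y * Real.sin ((1 + 2 * T) * t) := by
  have hsin := Real.sin_pos_of_mem_Ioo ht
  rw [← forall_real_quadratic_ne_zero_iff hsin]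
  constructor
  · intro h w hw hroot
    obtain ⟨z, rfl⟩ := IsAlgClosed.exists_pow_nat_eq w hT.bot_lt
    have hz : z ≠ 0 := by
      rintro rfl
      simp [zero_pow hT, -ofReal_sin, hsin.ne'] at hroot
    have hz1 : ‖z‖ < 1 := by rwa [norm_pow, pow_lt_one_iff_of_nonneg (norm_nonneg z) hT] at hw
    refine h ‖z‖ ⟨norm_pos_iff.2 hz, hz1⟩ z rfl (sub_eq_zero.1 ?_)
    rw [aeval_trinomialT_mul_exp_sub, hroot, mul_zero]
  · rintro h _ ⟨hz, hz1⟩ z rfl heq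
    have hdiff := aeval_trinomialT_mul_exp_sub T x y t z
    rw [heq, sub_self, zero_eq_mul] at hdiff
    refine h (z ^ T) (norm_pow z T ▸ pow_lt_one₀ (norm_nonneg z) hz1 hT) (hdiff.resolve_left ?_)
    exact mul_ne_zero (mul_ne_zero two_ne_zero I_ne_zero) (norm_pos_iff.1 hz)

theorem forall_injOn_sphere_trinomialT_iff (hT : T ≠ 0) :
    (∀ r ∈ Ioo (0 : ℝ) 1, InjOn (fun z : ℂ => aeval z (trinomialT T x y)) (Metric.sphere 0 r)) ↔
      ∀ t ∈ Ioo 0 Real.pi, |y * Real.sin ((1 + 2 * T) * t)| ≤ Real.sin t ∧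
        |x * Real.sin ((1 + T) * t)| ≤ Real.sin t + y * Real.sin ((1 + 2 * T) * t) := by
  calc _ ↔ ∀ r ∈ Ioo (0 : ℝ) 1, ∀ t ∈ Ioo 0 Real.pi, ∀ z : ℂ, ‖z‖ = r →
        aeval (z * exp (t * I)) (trinomialT T x y) ≠
          aeval (z * exp (-(t * I))) (trinomialT T x y) :=
        forall₂_congr fun r hr => injOn_sphere_iff_forall_mul_exp_ne hr.1
    _ ↔ ∀ t ∈ Ioo 0 Real.pi, ∀ r ∈ Ioo (0 : ℝ) 1, ∀ z : ℂ, ‖z‖ = r →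
        aeval (z * exp (t * I)) (trinomialT T x y) ≠
          aeval (z * exp (-(t * I))) (trinomialT T x y) :=
        ⟨fun h t ht r hr => h r hr t ht, fun h r hr t ht => h t ht r hr⟩
    _ ↔ _ := forall₂_congr fun t ht => forall_aeval_trinomialT_mul_exp_ne_iff hT ht

theorem hasDerivAt_const_mul_sin_zero (m c : ℝ) :
    HasDerivAt (fun t => c * Real.sin (m * t)) (m * c) 0 := by
  simpa [mul_comm] using (hasDerivAt_sin_const_mul m 0).const_mul c

theorem abs_mul_top_le_one
    (h : ∀ t ∈ Ioo 0 Real.pi, |y * Real.sin ((1 + 2 * T) * t)| ≤ Real.sin t) :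
    |(1 + 2 * T) * y| ≤ 1 := by
  have hsin : HasDerivAt Real.sin 1 0 := by simpa using Real.hasDerivAt_sin 0
  refine norm_le_of_eventually_norm_sub_le
    (hasDerivAt_const_mul_sin_zero (1 + 2 * T) y).hasDerivWithinAt hsin.hasDerivWithinAt ?_
  filter_upwards [Ioo_mem_nhdsGT Real.pi_pos] with t ht
  simpa using h t ht

theorem abs_mul_middle_le_one_add_mul_top
    (h : ∀ t ∈ Ioo 0 Real.pi,
      |x * Real.sin ((1 + T) * t)| ≤ Real.sin t + y * Real.sin ((1 + 2 * T) * t)) :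
    |(1 + T) * x| ≤ 1 + (1 + 2 * T) * y := by
  have hsin : HasDerivAt (fun t => Real.sin t + y * Real.sin ((1 + 2 * T) * t))
      (1 + (1 + 2 * T) * y) 0 :=
    (Real.cos_zero ▸ Real.hasDerivAt_sin 0).add (hasDerivAt_const_mul_sin_zero (1 + 2 * T) y)
  refine norm_le_of_eventually_norm_sub_le
    (hasDerivAt_const_mul_sin_zero (1 + T) x).hasDerivWithinAt hsin.hasDerivWithinAt ?_
  filter_upwards [Ioo_mem_nhdsGT Real.pi_pos] with t ht
  simpa using h t ht

theorem trinomialT_mem_univalentTrinomials_iff (hT : T ≠ 0) :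
    trinomialT T x y ∈ univalentTrinomials T ↔
      ∀ t ∈ Ioo 0 Real.pi, |y * Real.sin ((1 + 2 * T) * t)| ≤ Real.sin t ∧
        |x * Real.sin ((1 + T) * t)| ≤ Real.sin t + y * Real.sin ((1 + 2 * T) * t) := by
  constructor
  · rintro ⟨-, hinj⟩
    refine (forall_injOn_sphere_trinomialT_iff hT).1 fun r hr => hinj.mono ?_
    exact Metric.sphere_subset_closedBall.trans (Metric.closedBall_subset_ball hr.2)
  · intro h
    refine ⟨⟨x, y, rfl⟩, injOn_ball_of_isLocalHomeomorphOn ?_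
      ((forall_injOn_sphere_trinomialT_iff hT).2 h)⟩
    refine isLocalHomeomorphOn_of_hasStrictDerivAt
      (fun z _ => (trinomialT T x y).hasStrictDerivAt_aeval z) fun z hz => ?_
    rw [aeval_derivative_trinomialT]
    refine (forall_real_quadratic_ne_zero_iff one_pos).2
      ⟨abs_mul_top_le_one fun t ht => (h t ht).1,
        abs_mul_middle_le_one_add_mul_top fun t ht => (h t ht).2⟩ (z ^ T) ?_
    exact norm_pow z T ▸ pow_lt_one₀ (norm_nonneg z) (mem_ball_zero_iff.1 hz) hT

end DieudonneCriterion

section Trinomials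

open Real

theorem coeff_trinomialT (T : ℕ) (x y : ℝ) (k : ℕ) :
    (trinomialT T x y).coeff k =
      (if k = 1 then 1 else 0) + (if k = 1 + T then x else 0) + if k = 1 + 2 * T then y else 0 := by
  simp only [trinomialT, coeff_add, coeff_X, coeff_C_mul, coeff_X_pow, mul_ite, mul_one, mul_zero,
    eq_comm (a := 1) (b := k)]

theorem eval_one_trinomialT (T : ℕ) (x y : ℝ) : (trinomialT T x y).eval 1 = 1 + x + y := by
  simp [trinomialT]

theorem norm_exp_I_mul_pi_div (T : ℕ) : ‖Complex.exp (Complex.I * π / T)‖ = 1 := by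
  rw [show Complex.I * π / T = ((π / T : ℝ) : ℂ) * Complex.I by push_cast; ring]
  exact Complex.norm_exp_ofReal_mul_I _

theorem norm_aeval_le_maxModulus (P : ℝ[X]) {z : ℂ} (hz : ‖z‖ ≤ 1) :
    ‖aeval z P‖ ≤ maxModulus P :=
  le_csSup ((isCompact_closedBall 0 1).bddAbove_image P.continuous_aeval.norm.continuousOn)
    ⟨z, mem_closedBall_zero_iff.2 hz, rfl⟩

theorem maxModulus_trinomialT_le (T : ℕ) (x y : ℝ) :
    maxModulus (trinomialT T x y) ≤ 1 + |x| + |y| := by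
  refine csSup_le ((Metric.nonempty_closedBall.2 zero_le_one).image _) ?_
  rintro _ ⟨z, hz, rfl⟩
  have hz1 : ‖z‖ ≤ 1 := mem_closedBall_zero_iff.1 hz
  calc ‖aeval z (trinomialT T x y)‖
      ≤ ‖z‖ + |x| * ‖z‖ ^ (1 + T) + |y| * ‖z‖ ^ (1 + 2 * T) := by
        rw [aeval_trinomialT]
        refine norm_add₃_le.trans_eq ?_
        simp only [norm_mul, norm_pow, Complex.norm_real, norm_eq_abs]
    _ ≤ 1 + |x| * 1 + |y| * 1 := by
        gcongr <;> exact pow_le_one₀ (norm_nonneg z) hz1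
    _ = 1 + |x| + |y| := by rw [mul_one, mul_one]

variable {T : ℕ}

theorem coeff_trinomialT_middle (hT : T ≠ 0) (x y : ℝ) :
    (trinomialT T x y).coeff (1 + T) = x := by
  rw [coeff_trinomialT, if_neg (by lia), if_pos rfl, if_neg (by lia), zero_add, add_zero]

theorem coeff_trinomialT_top (hT : T ≠ 0) (x y : ℝ) :
    (trinomialT T x y).coeff (1 + 2 * T) = y := by
  rw [coeff_trinomialT, if_neg (by lia), if_neg (by lia), if_pos rfl, zero_add, zero_add]

theorem trinomialT_inj (hT : T ≠ 0) {x y x' y' : ℝ} :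
    trinomialT T x y = trinomialT T x' y' ↔ x = x' ∧ y = y' := by
  refine ⟨fun h => ⟨?_, ?_⟩, fun h => h.1 ▸ h.2 ▸ rfl⟩
  · rw [← coeff_trinomialT_middle hT x y, h, coeff_trinomialT_middle hT]
  · rw [← coeff_trinomialT_top hT x y, h, coeff_trinomialT_top hT]

theorem neg_trinomialT_comp_neg_X (hT : Odd T) (x y : ℝ) :
    -(trinomialT T x y).comp (-X) = trinomialT T (-x) y := by
  have hmiddle : Even (1 + T) := odd_one.add_odd hT
  have htop : Odd (1 + 2 * T) := odd_one.add_even (even_two_mul T)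
  simp only [trinomialT, add_comp, mul_comp, C_comp, X_comp, X_pow_comp, hmiddle.neg_pow,
    htop.neg_pow, C_neg]
  ring

theorem exp_I_mul_pi_div_pow (hT : T ≠ 0) : Complex.exp (Complex.I * π / T) ^ T = -1 := by
  rw [← Complex.exp_nat_mul, mul_div_cancel₀ _ (Nat.cast_ne_zero.2 hT), mul_comm,
    Complex.exp_pi_mul_I]

theorem aeval_exp_I_mul_pi_div_mul (hT : T ≠ 0) (x y : ℝ) (z : ℂ) :
    aeval (Complex.exp (Complex.I * π / T) * z) (trinomialT T x y) =
      Complex.exp (Complex.I * π / T) * aeval z (trinomialT T (-x) y) := by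
  simp only [aeval_trinomialT, mul_pow, pow_add, pow_one, mul_comm 2 T, pow_mul,
    exp_I_mul_pi_div_pow hT]
  push_cast
  ring

theorem norm_aeval_exp_I_mul_pi_div (hT : T ≠ 0) (x y : ℝ) :
    ‖aeval (Complex.exp (Complex.I * π / T)) (trinomialT T x y)‖ = |1 - x + y| := by
  have hrotate := aeval_exp_I_mul_pi_div_mul hT x y 1
  rw [mul_one] at hrotate
  rw [hrotate, norm_mul, norm_exp_I_mul_pi_div, one_mul, aeval_trinomialT, one_pow, one_pow,
    mul_one, mul_one, ← norm_eq_abs, ← Complex.norm_real]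
  congr 1
  push_cast
  ring

theorem maxModulus_trinomialT (hT : T ≠ 0) (x : ℝ) {y : ℝ} (hy : 0 ≤ y) :
    maxModulus (trinomialT T x y) = 1 + |x| + y := by
  refine le_antisymm ((maxModulus_trinomialT_le T x y).trans_eq (by rw [abs_of_nonneg hy])) ?_
  rcases le_total 0 x with hx | hx
  · refine le_trans ?_ (norm_aeval_le_maxModulus _ norm_one.le)
    rw [aeval_trinomialT, one_pow, one_pow, mul_one, mul_one, abs_of_nonneg hx]
    exact_mod_cast le_norm_self (1 + x + y)
  · refine le_trans ?_ (norm_aeval_le_maxModulus _ (norm_exp_I_mul_pi_div T).le)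
    rw [norm_aeval_exp_I_mul_pi_div hT, abs_of_nonpos hx]
    exact le_abs_self _

theorem angularRatio_trinomialT (hT : T ≠ 0) (x y : ℝ) :
    angularRatio T (trinomialT T x y) = |1 - x + y| / (1 + x + y) := by
  rw [angularRatio, norm_aeval_exp_I_mul_pi_div hT, eval_one_trinomialT]

end Trinomials

section CoefficientRegion

open Real Set Filter Topology

variable {T : ℕ} {x y : ℝ}

theorem abs_top_coeff_le (hT : T ≠ 0) (h : trinomialT T x y ∈ univalentTrinomials T) :
    |y| ≤ 1 / (1 + 2 * T) := by
  have hd : (0 : ℝ) < 1 + 2 * T := by positivity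
  have htop := abs_mul_top_le_one fun t ht =>
    ((trinomialT_mem_univalentTrinomials_iff hT).1 h t ht).1
  rwa [abs_mul, abs_of_pos hd, ← le_div_iff₀' hd] at htop

theorem one_add_top_coeff_pos (hT : T ≠ 0) (h : trinomialT T x y ∈ univalentTrinomials T) :
    0 < 1 + y := by
  have hlt : 1 / (1 + 2 * (T : ℝ)) < 1 := by
    rw [div_lt_one (by positivity)]
    linarith [Nat.cast_pos (α := ℝ).2 hT.bot_lt]
  linarith [neg_le_of_abs_le (abs_top_coeff_le hT h)]

theorem sin_suffridgeAngle_pos (T : ℕ) : 0 < sin (suffridgeAngle T) :=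
  sin_pos_of_mem_Ioo (suffridgeAngle_mem_Ioo T)

theorem cos_suffridgeAngle_pos (hT : T ≠ 0) : 0 < cos (suffridgeAngle T) := by
  have hpos := suffridgeAngle_pos T
  refine cos_pos_of_mem_Ioo ⟨by linarith [pi_pos], ?_⟩
  have : 0 < T * suffridgeAngle T := mul_pos (Nat.cast_pos.2 hT.bot_lt) hpos
  linarith [one_add_mul_suffridgeAngle T]

theorem sin_suffridgeAngle_lt_one (hT : T ≠ 0) : sin (suffridgeAngle T) < 1 := by
  nlinarith [cos_suffridgeAngle_pos hT, sin_suffridgeAngle_pos T,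
    sin_sq_add_cos_sq (suffridgeAngle T)]

theorem abs_middle_coeff_le (hT : T ≠ 0) (h : trinomialT T x y ∈ univalentTrinomials T) :
    |x| ≤ sin (suffridgeAngle T) * (1 + y) := by
  have hα := ((trinomialT_mem_univalentTrinomials_iff hT).1 h _ (suffridgeAngle_mem_Ioo T)).2
  rw [one_add_mul_suffridgeAngle, sin_pi_div_two, mul_one, one_add_two_mul_mul_suffridgeAngle,
    sin_pi_sub] at hα
  linarith

theorem top_coeff_eq_of_abs_middle_coeff_eq (hT : T ≠ 0)
    (h : trinomialT T x y ∈ univalentTrinomials T)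
    (hx : |x| = sin (suffridgeAngle T) * (1 + y)) : y = 1 / (1 + 2 * T) := by
  set α := suffridgeAngle T
  have hmin : IsLocalMin
      (fun t => sin t + y * sin ((1 + 2 * T) * t) - |x| * sin ((1 + T) * t)) α := by
    filter_upwards [Ioo_mem_nhds (suffridgeAngle_mem_Ioo T).1 (suffridgeAngle_mem_Ioo T).2]
      with t ht
    rw [one_add_mul_suffridgeAngle, one_add_two_mul_mul_suffridgeAngle, sin_pi_div_two, sin_pi_sub]
    have hle : |x| * sin ((1 + T) * t) ≤ |x * sin ((1 + T) * t)| := by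
      rw [abs_mul]
      exact mul_le_mul_of_nonneg_left (le_abs_self _) (abs_nonneg x)
    linarith [((trinomialT_mem_univalentTrinomials_iff hT).1 h t ht).2]
  have hderiv := hmin.hasDerivAt_eq_zero <|
    ((hasDerivAt_sin α).add ((hasDerivAt_sin_const_mul (1 + 2 * T) α).const_mul y)).sub
      ((hasDerivAt_sin_const_mul (1 + T) α).const_mul |x|)
  rw [one_add_mul_suffridgeAngle, one_add_two_mul_mul_suffridgeAngle, cos_pi_div_two,
    cos_pi_sub] at hderiv
  rw [eq_div_iff (by positivity)]
  refine mul_left_cancel₀ (cos_suffridgeAngle_pos hT).ne' ?_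
  linear_combination -hderiv

/-- The coefficient of `S^(T)` at `z^(1+T)`. -/
noncomputable def suffridgeMiddleCoeff (T : ℕ) : ℝ :=
  2 * (1 + T) / (1 + 2 * T) * sin (suffridgeAngle T)

theorem suffridgeMiddleCoeff_eq (T : ℕ) :
    suffridgeMiddleCoeff T = sin (suffridgeAngle T) * (1 + 1 / (1 + 2 * T)) := by
  rw [suffridgeMiddleCoeff]
  field_simp
  ring

theorem suffridgeMiddleCoeff_pos (T : ℕ) : 0 < suffridgeMiddleCoeff T := by
  have := sin_suffridgeAngle_pos T
  rw [suffridgeMiddleCoeff]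
  positivity

theorem trinomialT_mem_univalentTrinomials_of_abs_eq (hT : T ≠ 0)
    (hx : |x| = suffridgeMiddleCoeff T) :
    trinomialT T x (1 / (1 + 2 * T)) ∈ univalentTrinomials T := by
  have hd : (0 : ℝ) < 1 + 2 * T := by positivity
  refine (trinomialT_mem_univalentTrinomials_iff hT).2 fun t ht => ⟨?_, ?_⟩
  · rw [abs_mul, abs_of_pos (one_div_pos.2 hd), one_div_mul_eq_div, div_le_iff₀' hd]
    exact abs_sin_one_add_two_mul_le T (Ioo_subset_Icc_self ht)
  · rw [abs_mul, hx, suffridgeMiddleCoeff, ← mul_le_mul_iff_right₀ hd]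
    calc (1 + 2 * T) * (2 * (1 + T) / (1 + 2 * T) * sin (suffridgeAngle T) * |sin ((1 + T) * t)|)
        = 2 * (1 + T) * sin (suffridgeAngle T) * |sin ((1 + T) * t)| := by field_simp
      _ ≤ (1 + 2 * T) * sin t + sin ((1 + 2 * T) * t) := mul_abs_sin_one_add_mul_le ht
      _ = (1 + 2 * T) * (sin t + 1 / (1 + 2 * T) * sin ((1 + 2 * T) * t)) := by field_simp

theorem abs_middle_coeff_add_abs_top_coeff_le (hT : T ≠ 0)
    (h : trinomialT T x y ∈ univalentTrinomials T) :
    |x| + |y| ≤ suffridgeMiddleCoeff T + 1 / (1 + 2 * T) := by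
  have hs := sin_suffridgeAngle_pos T
  calc |x| + |y|
      ≤ sin (suffridgeAngle T) * (1 + y) + |y| := add_le_add (abs_middle_coeff_le hT h) le_rfl
    _ ≤ sin (suffridgeAngle T) * (1 + 1 / (1 + 2 * T)) + 1 / (1 + 2 * T) := by
      gcongr
      exacts [(le_abs_self y).trans (abs_top_coeff_le hT h), abs_top_coeff_le hT h]
    _ = suffridgeMiddleCoeff T + 1 / (1 + 2 * T) := by rw [suffridgeMiddleCoeff_eq]

theorem abs_middle_coeff_add_abs_top_coeff_eq_iff (hT : T ≠ 0)
    (h : trinomialT T x y ∈ univalentTrinomials T) :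
    |x| + |y| = suffridgeMiddleCoeff T + 1 / (1 + 2 * T) ↔
      |x| = suffridgeMiddleCoeff T ∧ y = 1 / (1 + 2 * T) := by
  have hs := sin_suffridgeAngle_pos T
  have hd : (0 : ℝ) < 1 / (1 + 2 * T) := by positivity
  constructor
  · intro heq
    have hx := abs_middle_coeff_le hT h
    have hy := abs_top_coeff_le hT h
    rw [suffridgeMiddleCoeff_eq] at heq ⊢
    have htop : y = 1 / (1 + 2 * T) :=
      le_antisymm ((le_abs_self y).trans hy) (by nlinarith)
    rw [htop, abs_of_pos hd] at heq
    exact ⟨by linarith, htop⟩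
  · rintro ⟨hx, rfl⟩
    rw [hx, abs_of_pos hd]

end CoefficientRegion

section ExtremalTrinomials

open Real Set

/-- The trinomial `Q^(T)(z) = e^(-iπ/T) S^(T)(e^(iπ/T) z)`, given by its real coefficients. -/
noncomputable def rotatedSuffridgeT (T : ℕ) : ℝ[X] :=
  trinomialT T (-suffridgeMiddleCoeff T) (1 / (1 + 2 * T))

variable {T : ℕ} {x y : ℝ} {P : ℝ[X]}

theorem suffridgeT_three (hT : T ≠ 0) :
    suffridgeT T 3 = trinomialT T (suffridgeMiddleCoeff T) (1 / (1 + 2 * T)) := by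
  have hα := one_add_mul_suffridgeAngle T
  have hs := (sin_suffridgeAngle_pos T).ne'
  have hc := (cos_suffridgeAngle_pos hT).ne'
  rw [suffridgeMiddleCoeff]
  have hscale (a : ℝ) : π * a / (2 + T * 2) = a * suffridgeAngle T := by
    rw [suffridgeAngle]; ring
  set α := suffridgeAngle T
  have hsin2 : sin (2 * α) = 2 * sin α * cos α := sin_two_mul α
  have hsinT : sin (T * α) = cos α := by
    rw [← sin_pi_div_two_sub]; congr 1; linear_combination hα
  have hsin2T : sin ((2 + T) * α) = cos α := by
    rw [← hsinT, ← sin_pi_sub]; congr 1; linear_combination -2 * hα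
  have hsinT2 : sin (T * 2 * α) = 2 * sin α * cos α := by
    rw [← hsin2, ← sin_pi_sub]; congr 1; linear_combination -2 * hα
  rw [suffridgeT, show Finset.Icc 2 3 = {2, 3} from rfl, Finset.sum_pair (by norm_num),
    show Finset.Icc 1 (2 - 1) = {1} from rfl, show Finset.Icc 1 (3 - 1) = {1, 2} from rfl,
    Finset.prod_singleton, Finset.prod_pair (by norm_num), trinomialT, ← add_assoc]
  norm_num only [Nat.cast_one, Nat.cast_ofNat, mul_one, mul_zero, add_zero, one_mul]
  rw [mul_assoc π, hscale, hscale, hscale, hscale, hsin2, hsinT, hsin2T, hsinT2, add_comm T 1,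
    add_comm (T * 2) 1, mul_comm T 2]
  congr 3
  · congr 1
    field_simp
    ring
  · field_simp
    ring

theorem suffridgeT_three_mem_univalentTrinomials (hT : T ≠ 0) :
    suffridgeT T 3 ∈ univalentTrinomials T :=
  suffridgeT_three hT ▸ trinomialT_mem_univalentTrinomials_of_abs_eq hT
    (abs_of_pos (suffridgeMiddleCoeff_pos T))

theorem rotatedSuffridgeT_mem_univalentTrinomials (hT : T ≠ 0) :
    rotatedSuffridgeT T ∈ univalentTrinomials T :=
  trinomialT_mem_univalentTrinomials_of_abs_eq hT
    (by rw [abs_neg, abs_of_pos (suffridgeMiddleCoeff_pos T)])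

theorem aeval_rotatedSuffridgeT (hT : T ≠ 0) (z : ℂ) :
    aeval z (rotatedSuffridgeT T) = Complex.exp (-(Complex.I * π / T)) *
      aeval (Complex.exp (Complex.I * π / T) * z) (suffridgeT T 3) := by
  rw [suffridgeT_three hT, aeval_exp_I_mul_pi_div_mul hT, ← mul_assoc, ← Complex.exp_add,
    neg_add_cancel, Complex.exp_zero, one_mul, rotatedSuffridgeT]

theorem rotatedSuffridgeT_eq_neg_comp_neg_X (hT : Odd T) :
    rotatedSuffridgeT T = -(suffridgeT T 3).comp (-X) := by
  rw [suffridgeT_three hT.pos.ne', neg_trinomialT_comp_neg_X hT, rotatedSuffridgeT]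

theorem trinomialT_eq_suffridgeT_or_eq_rotatedSuffridgeT_iff (hT : T ≠ 0) :
    trinomialT T x y = suffridgeT T 3 ∨ trinomialT T x y = rotatedSuffridgeT T ↔
      |x| = suffridgeMiddleCoeff T ∧ y = 1 / (1 + 2 * T) := by
  rw [suffridgeT_three hT, rotatedSuffridgeT, trinomialT_inj hT, trinomialT_inj hT,
    ← or_and_right, abs_eq (suffridgeMiddleCoeff_pos T).le]

theorem abs_coeff_le_coeff_suffridgeT (hT : T ≠ 0) (hP : P ∈ univalentTrinomials T)
    (htop : P.coeff (1 + 2 * T) = 1 / (1 + 2 * T)) (k : ℕ) :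
    |P.coeff k| ≤ (suffridgeT T 3).coeff k := by
  obtain ⟨x, y, rfl⟩ := hP.1
  rw [coeff_trinomialT_top hT] at htop
  have hx : |x| ≤ suffridgeMiddleCoeff T := by
    rw [suffridgeMiddleCoeff_eq, ← htop]
    exact abs_middle_coeff_le hT hP
  rw [suffridgeT_three hT, coeff_trinomialT, coeff_trinomialT, ← htop]
  refine (abs_add_three _ _ _).trans (add_le_add_three ?_ ?_ ?_) <;> split_ifs
  · exact abs_one.le
  · exact abs_zero.le
  · exact hx
  · exact abs_zero.le
  · exact (abs_of_pos (htop ▸ by positivity)).le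
  · exact abs_zero.le

theorem abs_coeff_middle_eq_iff (hT : T ≠ 0) (hP : P ∈ univalentTrinomials T)
    (htop : P.coeff (1 + 2 * T) = 1 / (1 + 2 * T)) :
    |P.coeff (1 + T)| = (suffridgeT T 3).coeff (1 + T) ↔
      P = suffridgeT T 3 ∨ P = rotatedSuffridgeT T := by
  obtain ⟨x, y, rfl⟩ := hP.1
  rw [coeff_trinomialT_top hT] at htop
  rw [trinomialT_eq_suffridgeT_or_eq_rotatedSuffridgeT_iff hT, and_iff_left htop,
    suffridgeT_three hT, coeff_trinomialT_middle hT, coeff_trinomialT_middle hT]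

theorem maxModulus_le_eval_one_suffridgeT (hT : T ≠ 0) (hP : P ∈ univalentTrinomials T) :
    maxModulus P ≤ (suffridgeT T 3).eval 1 := by
  obtain ⟨x, y, rfl⟩ := hP.1
  rw [suffridgeT_three hT, eval_one_trinomialT]
  linarith [maxModulus_trinomialT_le T x y, abs_middle_coeff_add_abs_top_coeff_le hT hP]

theorem maxModulus_eq_eval_one_suffridgeT_iff (hT : T ≠ 0) (hP : P ∈ univalentTrinomials T) :
    maxModulus P = (suffridgeT T 3).eval 1 ↔ P = suffridgeT T 3 ∨ P = rotatedSuffridgeT T := by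
  obtain ⟨x, y, rfl⟩ := hP.1
  rw [trinomialT_eq_suffridgeT_or_eq_rotatedSuffridgeT_iff hT, suffridgeT_three hT,
    eval_one_trinomialT]
  constructor
  · intro h
    refine (abs_middle_coeff_add_abs_top_coeff_eq_iff hT hP).1 ?_
    exact (abs_middle_coeff_add_abs_top_coeff_le hT hP).antisymm
      (by linarith [maxModulus_trinomialT_le T x y])
  · rintro ⟨hx, rfl⟩
    rw [maxModulus_trinomialT hT x (by positivity), hx]

theorem isGreatest_maxModulus (hT : T ≠ 0) :
    IsGreatest (maxModulus '' univalentTrinomials T) ((suffridgeT T 3).eval 1) := by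
  have hS := suffridgeT_three_mem_univalentTrinomials hT
  refine ⟨⟨_, hS, (maxModulus_eq_eval_one_suffridgeT_iff hT hS).2 (Or.inl rfl)⟩, ?_⟩
  rintro _ ⟨P, hP, rfl⟩
  exact maxModulus_le_eval_one_suffridgeT hT hP

theorem eval_one_pos_of_mem_univalentTrinomials (hT : T ≠ 0) (hP : P ∈ univalentTrinomials T) :
    0 < P.eval 1 := by
  obtain ⟨x, y, rfl⟩ := hP.1
  rw [eval_one_trinomialT]
  nlinarith [neg_le_of_abs_le (abs_middle_coeff_le hT hP), one_add_top_coeff_pos hT hP,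
    sin_suffridgeAngle_lt_one hT]

theorem angularRatio_eq_div (hT : T ≠ 0) (h : trinomialT T x y ∈ univalentTrinomials T) :
    angularRatio T (trinomialT T x y) = (1 + y - x) / (1 + y + x) := by
  have hnonneg : 0 ≤ 1 - x + y := by
    nlinarith [le_of_abs_le (abs_middle_coeff_le hT h), one_add_top_coeff_pos hT h,
      sin_suffridgeAngle_lt_one hT]
  rw [angularRatio_trinomialT hT, abs_of_nonneg hnonneg, sub_add_eq_add_sub, add_right_comm]

theorem angularRatio_suffridgeT (hT : T ≠ 0) :
    angularRatio T (suffridgeT T 3) =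
      (1 - sin (suffridgeAngle T)) / (1 + sin (suffridgeAngle T)) := by
  have hS := suffridgeT_three_mem_univalentTrinomials hT
  have hs := sin_suffridgeAngle_pos T
  rw [suffridgeT_three hT] at hS ⊢
  rw [angularRatio_eq_div hT hS, suffridgeMiddleCoeff_eq]
  field_simp

theorem one_sub_sin_div_one_add_sin {t : ℝ} (ht : cos t ≠ 0) :
    (1 - sin t) / (1 + sin t) = ((1 - sin t) / cos t) ^ 2 := by
  have hprod : (1 - sin t) * (1 + sin t) = cos t ^ 2 := by
    linear_combination -sin_sq_add_cos_sq t
  have hne : (1 - sin t) * (1 + sin t) ≠ 0 := hprod ▸ pow_ne_zero 2 ht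
  rw [div_pow, ← hprod, sq, mul_div_mul_left _ _ (left_ne_zero_of_mul hne)]

theorem angularRatio_suffridgeT_le (hT : T ≠ 0) (hP : P ∈ univalentTrinomials T) :
    angularRatio T (suffridgeT T 3) ≤ angularRatio T P := by
  obtain ⟨x, y, rfl⟩ := hP.1
  have hpos := eval_one_pos_of_mem_univalentTrinomials hT hP
  rw [eval_one_trinomialT] at hpos
  rw [angularRatio_suffridgeT hT, angularRatio_eq_div hT hP,
    div_le_div_iff₀ (by linarith [sin_suffridgeAngle_pos T]) (by linarith)]
  nlinarith [le_of_abs_le (abs_middle_coeff_le hT hP)]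

theorem isLeast_angularRatio (hT : T ≠ 0) :
    IsLeast (angularRatio T '' univalentTrinomials T) (angularRatio T (suffridgeT T 3)) := by
  refine ⟨mem_image_of_mem _ (suffridgeT_three_mem_univalentTrinomials hT), ?_⟩
  rintro _ ⟨P, hP, rfl⟩
  exact angularRatio_suffridgeT_le hT hP

theorem angularRatio_eq_angularRatio_suffridgeT_iff (hT : T ≠ 0)
    (hP : P ∈ univalentTrinomials T) :
    angularRatio T P = angularRatio T (suffridgeT T 3) ↔ P = suffridgeT T 3 := by
  refine ⟨fun h => ?_, fun h => h ▸ rfl⟩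
  obtain ⟨x, y, rfl⟩ := hP.1
  have hs := sin_suffridgeAngle_pos T
  have hpos := eval_one_pos_of_mem_univalentTrinomials hT hP
  rw [eval_one_trinomialT] at hpos
  rw [angularRatio_suffridgeT hT, angularRatio_eq_div hT hP,
    div_eq_div_iff (by linarith) (by linarith)] at h
  have hx : x = sin (suffridgeAngle T) * (1 + y) := by linarith
  have hx0 : 0 ≤ x := hx ▸ mul_nonneg hs.le (one_add_top_coeff_pos hT hP).le
  have hy := top_coeff_eq_of_abs_middle_coeff_eq hT hP ((abs_of_nonneg hx0).trans hx)
  rw [suffridgeT_three hT, trinomialT_inj hT, suffridgeMiddleCoeff_eq, ← hy]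
  exact ⟨hx, rfl⟩

end ExtremalTrinomials

theorem mainTheorem2 (T : ℕ) (hT : 1 ≤ T) :
    -- the explicit form of `S^(T)` for `n = 3`, and its membership in the class
    suffridgeT T 3 =
        trinomialT T (2 * (1 + (T : ℝ)) / (1 + 2 * (T : ℝ)) * Real.sin (Real.pi / (2 + 2 * (T : ℝ))))
          (1 / (1 + 2 * (T : ℝ))) ∧
    suffridgeT T 3 ∈ univalentTrinomials T ∧
    -- the rotated polynomial `Q(z) = e^{-iπ/T} S^(T)(e^{iπ/T} z)` has real coefficients
    ∃ Q : Polynomial ℝ,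
      (∀ z : ℂ, Polynomial.aeval z Q =
        Complex.exp (-(Complex.I * Real.pi / T)) *
          Polynomial.aeval (Complex.exp (Complex.I * Real.pi / T) * z) (suffridgeT T 3)) ∧
      (Odd T → Q = -(suffridgeT T 3).comp (-Polynomial.X)) ∧
      Q ∈ univalentTrinomials T ∧
      Q.coeff (1 + 2 * T) = 1 / (1 + 2 * (T : ℝ)) ∧
      -- largest coefficients among trinomials with leading coefficient `1 / (1 + 2T)`
      (∀ P ∈ univalentTrinomials T, P.coeff (1 + 2 * T) = 1 / (1 + 2 * (T : ℝ)) →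
        (∀ k : ℕ, |P.coeff k| ≤ (suffridgeT T 3).coeff k) ∧
        (|P.coeff (1 + T)| = (suffridgeT T 3).coeff (1 + T) ↔ P = suffridgeT T 3 ∨ P = Q)) ∧
      -- largest maximum modulus
      IsGreatest (maxModulus '' univalentTrinomials T) ((suffridgeT T 3).eval 1) ∧
      (∀ P ∈ univalentTrinomials T,
        maxModulus P = (suffridgeT T 3).eval 1 ↔ P = suffridgeT T 3 ∨ P = Q) ∧
      -- smallest quotient `|P(e^{iπ/T})| / P(1)`
      (∀ P ∈ univalentTrinomials T, 0 < P.eval 1) ∧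
      IsLeast (angularRatio T '' univalentTrinomials T) (angularRatio T (suffridgeT T 3)) ∧
      angularRatio T (suffridgeT T 3) =
        ((1 - Real.sin (Real.pi / (2 + 2 * (T : ℝ)))) /
          Real.cos (Real.pi / (2 + 2 * (T : ℝ)))) ^ 2 ∧
      (∀ P ∈ univalentTrinomials T,
        angularRatio T P = angularRatio T (suffridgeT T 3) ↔ P = suffridgeT T 3) := by
  have hT0 : T ≠ 0 := Nat.one_le_iff_ne_zero.1 hT
  refine ⟨suffridgeT_three hT0, suffridgeT_three_mem_univalentTrinomials hT0, rotatedSuffridgeT T,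
    aeval_rotatedSuffridgeT hT0, rotatedSuffridgeT_eq_neg_comp_neg_X,
    rotatedSuffridgeT_mem_univalentTrinomials hT0, coeff_trinomialT_top hT0 _ _,
    fun P hP htop => ⟨abs_coeff_le_coeff_suffridgeT hT0 hP htop,
      abs_coeff_middle_eq_iff hT0 hP htop⟩,
    isGreatest_maxModulus hT0, fun P hP => maxModulus_eq_eval_one_suffridgeT_iff hT0 hP,
    fun P hP => eval_one_pos_of_mem_univalentTrinomials hT0 hP, isLeast_angularRatio hT0, ?_,
    fun P hP => angularRatio_eq_angularRatio_suffridgeT_iff hT0 hP⟩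
  exact (angularRatio_suffridgeT hT0).trans
    (one_sub_sin_div_one_add_sin (cos_suffridgeAngle_pos hT0).ne')
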